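/- For a finite family $H$ of $r$-element subsets of $\mathbb{N}$ (an $r$-graph, whose members are called its edges; $e(H)$ denotes their number), choose $n\ge 1$ such that all edges of $H$ are contained in $[n]=\{1,\dots,n\}$, and define the Lagrangian of $H$ by $$\lambda(H)=\max\Big\{\sum_{A\in H}\prod_{i\in A}y_i \ :\ y_1,\dots,y_n\ge 0,\ \sum_{i=1}^n y_i=1\Big\}$$ (the value does not depend on the choice of $n$). Let $\mathbb{N}^{(r)}$ and $[t]^{(r)}$ denote the families of all $r$-element subsets of $\mathbb{N}$ and of $[t]$, respectively. Then for every integer $r\ge 4$ there exists $t_r\in\mathbb{N}$ such that for all $t\in\mathbb{N}$ with $t\ge t_r$, $$\max\Big\{\lambda(H)\ :\ H\subseteq\mathbb{N}^{(r)},\ e(H)=\binom{t}{r}\Big\}=\lambda\big([t]^{(r)}\big)=\frac{1}{t^r}\binom{t}{r}.$$ -/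

import Mathlib

namespace HypergraphLagrangian

/-- The edge polynomial `L(H, y) = ∑_{A ∈ H} ∏_{i ∈ A} y_i` of a finite family `H` of finite sets of
natural numbers. -/
def edgePoly (H : Finset (Finset ℕ)) (y : ℕ → ℝ) : ℝ :=
  ∑ A ∈ H, ∏ i ∈ A, y i

/-- A weighting on a finite vertex set `V`: nonnegative weights on `V` with total weight `1`
(the standard simplex on `V`; values outside `V` are irrelevant). -/
def IsWeightingOn (V : Finset ℕ) (y : ℕ → ℝ) : Prop :=
  (∀ i ∈ V, 0 ≤ y i) ∧ ∑ i ∈ V, y i = 1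

/-- The Lagrangian of `H`: the supremum of `L(H, y)` over all weightings `y` on some finite vertex
set that contains all edges of `H`. By `isGreatest_lagrangian` below, this is a maximum, and it may
be computed on any one nonempty finite vertex set containing all edges. -/
noncomputable def lagrangian (H : Finset (Finset ℕ)) : ℝ :=
  sSup {x : ℝ | ∃ (V : Finset ℕ) (y : ℕ → ℝ),
    (∀ A ∈ H, A ⊆ V) ∧ IsWeightingOn V y ∧ edgePoly H y = x}

/-- The complete `r`-graph `[t]^{(r)}`: all `r`-element subsets of `{1, …, t}`. -/
def completeRGraph (t r : ℕ) : Finset (Finset ℕ) :=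
  (Finset.Icc 1 t).powersetCard r

/-- On a fixed nonempty finite vertex set `V` containing all edges of `H`, the maximum of `L(H, ·)`
over the standard simplex on `V` exists, and it equals `lagrangian H`. -/
theorem isGreatest_lagrangian (H : Finset (Finset ℕ)) (V : Finset ℕ) (hV : V.Nonempty)
    (hH : ∀ A ∈ H, A ⊆ V) :
    IsGreatest {x : ℝ | ∃ y : ℕ → ℝ, IsWeightingOn V y ∧ edgePoly H y = x} (lagrangian H) := by
  obtain ⟨v, hv⟩ := hV
  -- the maximum exists, by compactness
  have hmax : ∃ z : ℕ → ℝ, IsWeightingOn V z ∧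
      ∀ y : ℕ → ℝ, IsWeightingOn V y → edgePoly H y ≤ edgePoly H z := by
    let ext : (V → ℝ) → ℕ → ℝ := fun w i => if h : i ∈ V then w ⟨i, h⟩ else 0
    have hext : ∀ w : V → ℝ, ∀ i : V, ext w i = w i := fun w i => by simp [ext]
    have hcont : Continuous fun w : V → ℝ => edgePoly H (ext w) := by
      unfold edgePoly
      refine continuous_finsetSum _ fun A _ => continuous_finsetProd _ fun i _ => ?_
      by_cases h : i ∈ V
      · simpa [ext, h] using continuous_apply (⟨i, h⟩ : V)
      · simpa [ext, h] using continuous_const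
    have hne : (stdSimplex ℝ V).Nonempty := ⟨_, single_mem_stdSimplex ℝ (⟨v, hv⟩ : V)⟩
    obtain ⟨w, hw, hwm⟩ := (isCompact_stdSimplex ℝ V).exists_isMaxOn hne hcont.continuousOn
    refine ⟨ext w, ⟨fun i hi => ?_, ?_⟩, fun y hy => ?_⟩
    · rw [hext w ⟨i, hi⟩]; exact hw.1 _
    · rw [← Finset.sum_coe_sort V, ← hw.2]
      exact Finset.sum_congr rfl fun i _ => hext w i
    · have hmem : (fun i : V => y i) ∈ stdSimplex ℝ V :=
        ⟨fun i => hy.1 i i.2, by rw [Finset.sum_coe_sort V y]; exact hy.2⟩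
      have hle := hwm hmem
      have heq : edgePoly H (ext fun i : V => y i) = edgePoly H y := by
        unfold edgePoly
        refine Finset.sum_congr rfl fun A hA => Finset.prod_congr rfl fun i hi => ?_
        simp [ext, hH A hA hi]
      simpa [heq] using hle
  obtain ⟨z, hz, hzm⟩ := hmax
  -- every weighting on another vertex set is dominated by one on `V`
  have hdom : ∀ (W : Finset ℕ) (y : ℕ → ℝ), (∀ A ∈ H, A ⊆ W) → IsWeightingOn W y →
      edgePoly H y ≤ edgePoly H z := by
    intro W y hW hy
    let u : ℕ → ℝ := fun i => if i ∈ W then y i else 0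
    have hu : ∀ i, 0 ≤ u i := fun i => by
      by_cases h : i ∈ W
      · simpa [u, h] using hy.1 i h
      · simp [u, h]
    have hyu : edgePoly H y = edgePoly H u := by
      unfold edgePoly
      refine Finset.sum_congr rfl fun A hA => Finset.prod_congr rfl fun i hi => ?_
      simp [u, hW A hA hi]
    have hsum : ∑ i ∈ V, u i ≤ 1 := by
      have h1 : ∑ i ∈ V, u i = ∑ i ∈ V ∩ W, y i := by
        simp [u, Finset.sum_ite_mem]
      rw [h1, ← hy.2]
      exact Finset.sum_le_sum_of_subset_of_nonneg Finset.inter_subset_right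
        fun i hi _ => hy.1 i hi
    let c : ℝ := 1 - ∑ i ∈ V, u i
    have hc : 0 ≤ c := sub_nonneg.2 hsum
    let q : ℕ → ℝ := fun i => u i + if i = v then c else 0
    have huq : ∀ i, u i ≤ q i := fun i => by
      by_cases h : i = v <;> simp [q, h, hc]
    have hq : IsWeightingOn V q := by
      refine ⟨fun i _ => (hu i).trans (huq i), ?_⟩
      simp [q, Finset.sum_add_distrib, hv, c]
    rw [hyu]
    refine le_trans ?_ (hzm q hq)
    exact Finset.sum_le_sum fun A _ =>
      Finset.prod_le_prod (fun i _ => hu i) fun i _ => huq i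
  have hg : IsGreatest {x : ℝ | ∃ (W : Finset ℕ) (y : ℕ → ℝ),
      (∀ A ∈ H, A ⊆ W) ∧ IsWeightingOn W y ∧ edgePoly H y = x} (edgePoly H z) := by
    refine ⟨⟨V, z, hH, hz, rfl⟩, ?_⟩
    rintro x ⟨W, y, hW, hy, rfl⟩
    exact hdom W y hW hy
  have hl : lagrangian H = edgePoly H z := hg.csSup_eq
  rw [hl]
  refine ⟨⟨z, hz, rfl⟩, ?_⟩
  rintro x ⟨y, hy, rfl⟩
  exact hzm y hy

end HypergraphLagrangian

namespace HypergraphLagrangian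

open Finset

/-! The uniform weighting on `[t]` gives the lower bound. For the upper bound, take an optimal
weighting `y` of `H`, rescale it to `x = t * y`, and suppose that `L(H, x) > e(H) = t.choose r`.

Entropy: write `z_A` for the product of `x` over an edge `A`. Then `z log z ≥ z - 1` gives `∑ z_A
log z_A ≥ L(H, x) - e(H) > 0`. At an optimum the link values agree on all positive weights, so the
left side is a positive multiple of `∑ x_i log x_i`, which is therefore positive
(`mul_linkPoly_eq_of_isMax`, `edgePoly_sub_card_le`). The same optimality condition bounds every
`x_i` by `2 * r` (`le_of_pow_le`).

Symmetric functions: for bounded `x` with sum `t` and `∑ x log x ≥ 0`, every power sum `p_j` is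
within `O(E)` of `t`, where `E = p_2 - t ≥ 0`. Comparing Newton's identities for `x` with those for
`t` ones shows that `t.choose r - e_r(x)` is at least a positive multiple of `t ^ (r - 2) * E`, up
to an error `O(t ^ (r - 3) * E)`. Hence `L(H, x) ≤ e_r(x) ≤ t.choose r` for large `t`, a
contradiction. -/

/-! ### Newton's identities and their perturbation. -/

/-- Newton's identity for the elementary symmetric sums of a finite family of reals. -/
theorem newton_identity (V : Finset ℕ) (x : ℕ → ℝ) (k : ℕ) :
    ((k + 1 : ℕ) : ℝ) * edgePoly (V.powersetCard (k + 1)) x =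
      ∑ a ∈ range (k + 1), (-1) ^ (k + a) * edgePoly (V.powersetCard a) x *
        ∑ i ∈ V, x i ^ (k + 1 - a) := by
  have he : ∀ n, MvPolynomial.aeval (fun i : V => x i) (MvPolynomial.esymm V ℝ n) =
      edgePoly (V.powersetCard n) x := by
    intro n
    rw [MvPolynomial.aeval_esymm_eq_multiset_esymm]
    have : Multiset.map (fun i : V => x i) univ.val = V.val.map x := by
      rw [← Finset.attach_eq_univ]
      exact Multiset.attach_map_val' V.val x
    rw [this, Finset.esymm_map_val]
    rfl
  have hp : ∀ n, MvPolynomial.aeval (fun i : V => x i) (MvPolynomial.psum V ℝ n) =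
      ∑ i ∈ V, x i ^ n := by
    intro n
    simp only [MvPolynomial.psum, map_sum, map_pow, MvPolynomial.aeval_X]
    exact Finset.sum_coe_sort V fun i => x i ^ n
  have h := congrArg (MvPolynomial.aeval (fun i : V => x i))
    (MvPolynomial.mul_esymm_eq_sum V ℝ (k + 1))
  simp only [map_mul, map_sum, map_pow, map_natCast, map_neg, map_one, he, hp] at h
  rw [h, sum_filter, Finset.Nat.sum_antidiagonal_eq_sum_range_succ_mk, sum_range_succ]
  simp only [lt_self_iff_false, if_false, add_zero]
  rw [mul_sum]
  refine sum_congr rfl fun a ha => ?_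
  rw [if_pos (mem_range.1 ha)]
  ring

/-- Sequences `e`, `b` obeying Newton's identities for power sums `p` and `t, t, …` are close
when `p` is close to the constant `t`. -/
theorem abs_sub_le_of_newton {t E M : ℝ} (ht : 1 ≤ t) (hE : 0 ≤ E) (hM : 0 ≤ M)
    {e b p : ℕ → ℝ} (r : ℕ) (he0 : e 0 = 1) (hb0 : b 0 = 1)
    (he : ∀ k, |e k| ≤ t ^ k) (hp1 : p 1 = t)
    (hp : ∀ j, 1 ≤ j → j ≤ r → |p j - t| ≤ M * E)
    (hNe : ∀ k, ((k + 1 : ℕ) : ℝ) * e (k + 1) =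
      ∑ a ∈ range (k + 1), (-1) ^ (k + a) * e a * p (k + 1 - a))
    (hNb : ∀ k, ((k + 1 : ℕ) : ℝ) * b (k + 1) =
      ∑ a ∈ range (k + 1), (-1) ^ (k + a) * b a * t) :
    ∀ k, k ≤ r → t ^ 2 * |b k - e k| ≤ k * M * t ^ k * E := by
  have ht0 : 0 < t := by linarith
  intro k
  induction k using Nat.strong_induction_on with
  | _ k ih =>
  intro hk
  rcases k with _ | k
  · simp [he0, hb0]
  have hterm : ∀ a ∈ range (k + 1),
      t ^ 2 * |(b a - e a) * t - e a * (p (k + 1 - a) - t)| ≤ (k + 1 : ℝ) * M * t ^ (k + 1) * E := by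
    intro a ha
    have hak : a ≤ k := Nat.lt_succ_iff.1 (mem_range.1 ha)
    have h1 := ih a (by omega) (by omega)
    have hd : t ^ 2 * |(b a - e a) * t| ≤ (k : ℝ) * M * t ^ (k + 1) * E := by
      rw [abs_mul, abs_of_pos ht0]
      calc t ^ 2 * (|b a - e a| * t) = (t ^ 2 * |b a - e a|) * t := by ring
        _ ≤ (a * M * t ^ a * E) * t := by gcongr
        _ = a * M * t ^ (a + 1) * E := by ring
        _ ≤ k * M * t ^ (k + 1) * E := by gcongr
    have hpe : t ^ 2 * |e a * (p (k + 1 - a) - t)| ≤ M * t ^ (k + 1) * E := by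
      -- The case `a = k` would be one power of `t` too large; it vanishes because `p 1 = t`
      -- exactly.
      rcases hak.eq_or_lt with rfl | hlt
      · simp only [add_tsub_cancel_left, hp1, sub_self, mul_zero, abs_zero]
        positivity
      · rw [abs_mul]
        calc t ^ 2 * (|e a| * |p (k + 1 - a) - t|) ≤ t ^ 2 * (t ^ a * (M * E)) := by
              gcongr
              · exact he a
              · exact hp _ (by omega) (by omega)
          _ = M * t ^ (a + 2) * E := by ring
          _ ≤ M * t ^ (k + 1) * E := by
              have := pow_le_pow_right₀ ht (show a + 2 ≤ k + 1 by omega)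
              gcongr
    calc _ ≤ t ^ 2 * (|(b a - e a) * t| + |e a * (p (k + 1 - a) - t)|) := by
          gcongr; exact abs_sub _ _
      _ ≤ _ := by linarith
  have hsum : ((k + 1 : ℕ) : ℝ) * (b (k + 1) - e (k + 1)) =
      ∑ a ∈ range (k + 1), (-1) ^ (k + a) * ((b a - e a) * t - e a * (p (k + 1 - a) - t)) := by
    rw [mul_sub, hNe, hNb, ← sum_sub_distrib]
    exact sum_congr rfl fun a _ => by ring
  have hfin : ((k + 1 : ℕ) : ℝ) * (t ^ 2 * |b (k + 1) - e (k + 1)|) ≤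
      ((k + 1 : ℕ) : ℝ) * (((k + 1 : ℕ) : ℝ) * M * t ^ (k + 1) * E) := by
    calc _ = t ^ 2 * |((k + 1 : ℕ) : ℝ) * (b (k + 1) - e (k + 1))| := by
          rw [abs_mul, Nat.abs_cast]; ring
      _ ≤ t ^ 2 * ∑ a ∈ range (k + 1), |(b a - e a) * t - e a * (p (k + 1 - a) - t)| := by
          rw [hsum]
          gcongr
          refine (abs_sum_le_sum_abs _ _).trans_eq (sum_congr rfl fun a _ => ?_)
          rw [abs_mul, abs_pow, abs_neg, abs_one, one_pow, one_mul]
      _ ≤ ∑ a ∈ range (k + 1), (k + 1 : ℝ) * M * t ^ (k + 1) * E := by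
          rw [mul_sum]; exact sum_le_sum hterm
      _ = _ := by simp
  exact le_of_mul_le_mul_left hfin (by positivity)

/-- If the second power sum exceeds `t` by `E`, the leading term in the difference of two
sequences as in `abs_sub_le_of_newton` is `t ^ (k - 2) / k ! * E`. -/
theorem le_sub_of_newton {t E M : ℝ} (ht : 1 ≤ t) (hE : 0 ≤ E) (hM : 0 ≤ M)
    {e b p : ℕ → ℝ} (r : ℕ) (he0 : e 0 = 1) (hb0 : b 0 = 1)
    (he : ∀ k, |e k| ≤ t ^ k) (he' : ∀ k, 0 ≤ e k) (hp1 : p 1 = t) (hp2 : p 2 = t + E)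
    (hp : ∀ j, 1 ≤ j → j ≤ r → |p j - t| ≤ M * E)
    (hNe : ∀ k, ((k + 1 : ℕ) : ℝ) * e (k + 1) =
      ∑ a ∈ range (k + 1), (-1) ^ (k + a) * e a * p (k + 1 - a))
    (hNb : ∀ k, ((k + 1 : ℕ) : ℝ) * b (k + 1) =
      ∑ a ∈ range (k + 1), (-1) ^ (k + a) * b a * t) :
    ∀ k, 2 ≤ k → k ≤ r →
      (t ^ (k + 1) / k.factorial - (k : ℝ) ^ 2 * M * t ^ k) * E ≤ t ^ 3 * (b k - e k) := by
  have ht0 : 0 < t := by linarith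
  have hclose := abs_sub_le_of_newton ht hE hM r he0 hb0 he hp1 hp hNe hNb
  have hsum : ∀ k, ((k + 1 : ℕ) : ℝ) * (b (k + 1) - e (k + 1)) =
      ∑ a ∈ range (k + 1), (-1) ^ (k + a) * ((b a - e a) * t - e a * (p (k + 1 - a) - t)) := by
    intro k
    rw [mul_sub, hNe, hNb, ← sum_sub_distrib]
    exact sum_congr rfl fun a _ => by ring
  intro k hk
  induction k, hk using Nat.le_induction with
  | base =>
    intro _
    have h1 := hsum 0
    have h2 := hsum 1
    simp [sum_range_succ, he0, hb0, hp1, hp2] at h1 h2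
    rw [h1] at h2
    have : b 2 - e 2 = E / 2 := by linarith
    rw [this]
    have : 0 ≤ M * t ^ 2 * E := by positivity
    simp [Nat.factorial]
    nlinarith
  | succ k hk ih =>
    intro hkr
    have ih := ih (by omega)
    obtain ⟨l, rfl⟩ : ∃ l, k = l + 1 := ⟨k - 1, by omega⟩
    have hd : ∀ a, a ≤ l → t ^ 3 * |(b a - e a) * t| ≤ (l : ℝ) * M * t ^ (l + 2) * E := by
      intro a hal
      rw [abs_mul, abs_of_pos ht0]
      calc t ^ 3 * (|b a - e a| * t) = (t ^ 2 * |b a - e a|) * t ^ 2 := by ring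
        _ ≤ (a * M * t ^ a * E) * t ^ 2 :=
            mul_le_mul_of_nonneg_right (hclose a (by omega)) (by positivity)
        _ = a * M * t ^ (a + 2) * E := by ring
        _ ≤ l * M * t ^ (l + 2) * E := by gcongr
    have hrest : ∀ a ∈ range l, -(((l : ℝ) + 1) * M * t ^ (l + 2) * E) ≤ t ^ 3 *
        ((-1) ^ (l + 1 + a) * ((b a - e a) * t - e a * (p (l + 1 + 1 - a) - t))) := by
      intro a ha
      have hal := mem_range.1 ha
      have h1 := hd a hal.le
      have h2 : t ^ 3 * |e a * (p (l + 1 + 1 - a) - t)| ≤ M * t ^ (l + 2) * E := by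
        rw [abs_mul]
        calc t ^ 3 * (|e a| * |p (l + 1 + 1 - a) - t|) ≤ t ^ 3 * (t ^ a * (M * E)) := by
              gcongr
              · exact he a
              · exact hp _ (by omega) (by omega)
          _ = M * t ^ (a + 3) * E := by ring
          _ ≤ M * t ^ (l + 2) * E := by
              have := pow_le_pow_right₀ ht (show a + 3 ≤ l + 2 by omega)
              gcongr
      have h3 : t ^ 3 * |(-1) ^ (l + 1 + a) * ((b a - e a) * t - e a * (p (l + 1 + 1 - a) - t))| ≤
          ((l : ℝ) + 1) * M * t ^ (l + 2) * E := by
        rw [abs_mul, abs_pow, abs_neg, abs_one, one_pow, one_mul]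
        calc _ ≤ t ^ 3 * (|(b a - e a) * t| + |e a * (p (l + 1 + 1 - a) - t)|) := by
              gcongr; exact abs_sub _ _
          _ ≤ _ := by linarith
      have h4 := neg_abs_le
        ((-1) ^ (l + 1 + a) * ((b a - e a) * t - e a * (p (l + 1 + 1 - a) - t)))
      nlinarith [pow_pos ht0 3]
    have hrest' := sum_le_sum hrest
    rw [← mul_sum, sum_const, card_range, nsmul_eq_mul] at hrest'
    have hs := hsum (l + 1)
    rw [sum_range_succ, sum_range_succ] at hs
    have hp2' : p (l + 1 + 1 - l) = t + E := by
      rw [show l + 1 + 1 - l = 2 by omega, hp2]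
    have hp1' : p (l + 1 + 1 - (l + 1)) = t := by
      rw [show l + 1 + 1 - (l + 1) = 1 by omega, hp1]
    have hs1 : (-1 : ℝ) ^ (l + 1 + l) = -1 := Odd.neg_one_pow ⟨l, by ring⟩
    have hs2 : (-1 : ℝ) ^ (l + 1 + (l + 1)) = 1 := Even.neg_one_pow ⟨l + 1, by ring⟩
    rw [hp2', hp1', hs1, hs2] at hs
    have hmid := (mul_le_mul_of_nonneg_left (le_abs_self ((b l - e l) * t))
      (pow_nonneg ht0.le 3)).trans (hd l le_rfl)
    -- The index `a = l` contributes `+ e l * E`. Only its sign is used, so the coefficient `1 / k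
    -- !` arises from the `t * (b - e)` term of the recursion alone.
    have hel : 0 ≤ t ^ 3 * (e l * E) := mul_nonneg (by positivity) (mul_nonneg (he' l) hE)
    have ih' := mul_le_mul_of_nonneg_right ih ht0.le
    have hs' := congrArg (fun z => t ^ 3 * z) hs
    have hfac : t ^ (l + 1 + 1 + 1) / (l + 1 + 1).factorial * ((l : ℝ) + 2) =
        t ^ (l + 1 + 1) / (l + 1).factorial * t := by
      have := Nat.factorial_pos (l + 1)
      rw [Nat.factorial_succ (l + 1)]
      push_cast
      field_simp
      ring
    have hfac' := congrArg (fun z => z * E) hfac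
    have hMt : 0 ≤ M * t ^ (l + 2) * E := by positivity
    have hMt' : 0 ≤ (l : ℝ) * (M * t ^ (l + 2) * E) := by positivity
    have hMt'' : 0 ≤ (l : ℝ) ^ 2 * (M * t ^ (l + 2) * E) := by positivity
    have hMt3 : 0 ≤ (l : ℝ) ^ 3 * (M * t ^ (l + 2) * E) := by positivity
    refine le_of_mul_le_mul_right (a := (l : ℝ) + 2) ?_ (by positivity)
    push_cast at *
    ring_nf at *
    linarith

/-! ### Bounds on elementary symmetric sums. -/

theorem edgePoly_nonneg {H : Finset (Finset ℕ)} {V : Finset ℕ} {x : ℕ → ℝ}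
    (hH : ∀ A ∈ H, A ⊆ V) (hx : ∀ i ∈ V, 0 ≤ x i) : 0 ≤ edgePoly H x :=
  sum_nonneg fun A hA => prod_nonneg fun i hi => hx i (hH A hA hi)

/-- The elementary symmetric sums are at most `(∑ x) ^ k / k !`. -/
theorem factorial_mul_edgePoly_powersetCard_le (V : Finset ℕ) (x : ℕ → ℝ)
    (hx : ∀ i ∈ V, 0 ≤ x i) (k : ℕ) :
    (k.factorial : ℝ) * edgePoly (V.powersetCard k) x ≤ (∑ i ∈ V, x i) ^ k := by
  induction V using Finset.induction_on generalizing k with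
  | empty =>
    rcases k with _ | k
    · simp [edgePoly]
    · rw [powersetCard_eq_empty.2 (by simp)]
      simp [edgePoly]
  | insert a s ha ih =>
    have hs : ∀ i ∈ s, 0 ≤ x i := fun i hi => hx i (mem_insert_of_mem hi)
    have hxa : 0 ≤ x a := hx a (mem_insert_self _ _)
    have hS : 0 ≤ ∑ i ∈ s, x i := sum_nonneg hs
    rcases k with _ | k
    · simp [edgePoly]
    have hrec : edgePoly ((insert a s).powersetCard (k + 1)) x =
        edgePoly (s.powersetCard (k + 1)) x + x a * edgePoly (s.powersetCard k) x := by
      unfold edgePoly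
      rw [powersetCard_succ_insert ha, sum_union, sum_image, mul_sum]
      · congr 1
        refine sum_congr rfl fun A hA => prod_insert fun h => ha ((mem_powersetCard.1 hA).1 h)
      · intro A hA B hB hAB
        have hA' : a ∉ A := fun h => ha ((mem_powersetCard.1 hA).1 h)
        have hB' : a ∉ B := fun h => ha ((mem_powersetCard.1 hB).1 h)
        rw [← erase_insert hA', ← erase_insert hB', hAB]
      · rw [disjoint_left]
        rintro A hA hA'
        obtain ⟨B, _, rfl⟩ := mem_image.1 hA'
        exact ha ((mem_powersetCard.1 hA).1 (mem_insert_self _ _))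
    rw [hrec, sum_insert ha]
    -- These are the two terms of the binomial expansion of lowest degree in `x a`.
    have hpow : (∑ i ∈ s, x i) ^ (k + 1) + ((k + 1 : ℕ) : ℝ) * x a * (∑ i ∈ s, x i) ^ k ≤
        (x a + ∑ i ∈ s, x i) ^ (k + 1) := by
      rw [add_comm (x a), add_pow, sum_range_succ, sum_range_succ]
      have : 0 ≤ ∑ j ∈ range k, (∑ i ∈ s, x i) ^ j * x a ^ (k + 1 - j) * ((k + 1).choose j : ℝ) :=
        sum_nonneg fun j _ => by positivity
      simp
      nlinarith
    have h1 := ih hs (k + 1)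
    have h2 := mul_le_mul_of_nonneg_left (ih hs k) (mul_nonneg (Nat.cast_nonneg (α := ℝ) (k + 1)) hxa)
    have h3 : (((k + 1).factorial : ℕ) : ℝ) = ((k + 1 : ℕ) : ℝ) * k.factorial := by
      rw [Nat.factorial_succ]; push_cast; ring
    calc _ = ((k + 1).factorial : ℝ) * edgePoly (s.powersetCard (k + 1)) x +
          ((k + 1 : ℕ) : ℝ) * x a * (k.factorial * edgePoly (s.powersetCard k) x) := by
          rw [mul_add, h3]; ring
      _ ≤ _ := by linarith

theorem edgePoly_powersetCard_le (V : Finset ℕ) (x : ℕ → ℝ)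
    (hx : ∀ i ∈ V, 0 ≤ x i) (k : ℕ) :
    edgePoly (V.powersetCard k) x ≤ (∑ i ∈ V, x i) ^ k := by
  refine le_trans ?_ (factorial_mul_edgePoly_powersetCard_le V x hx k)
  refine le_mul_of_one_le_left (edgePoly_nonneg (fun A hA => (mem_powersetCard.1 hA).1) hx) ?_
  exact_mod_cast Nat.one_le_iff_ne_zero.2 (Nat.factorial_ne_zero k)

/-! ### Power sums and elementary symmetric sums under the entropy condition. -/

/-- With `x = u ^ 2`, the bound `log u ≤ u - 1` gives `x - 1 - log x ≥ (u - 1) ^ 2`, and `(u + 1) ^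
2` is bounded. This turns second-order Taylor errors into entropy. -/
theorem sq_sub_one_le {R x : ℝ} (hx : 0 < x) (hxR : x ≤ R) :
    (x - 1) ^ 2 ≤ 2 * (R + 1) * (x - 1 - Real.log x) := by
  obtain ⟨u, hu, rfl⟩ : ∃ u : ℝ, 0 < u ∧ u ^ 2 = x := ⟨√x, Real.sqrt_pos.2 hx, Real.sq_sqrt hx.le⟩
  have hlog : Real.log (u ^ 2) ≤ 2 * (u - 1) := by
    rw [Real.log_pow]
    have := Real.log_le_sub_one_of_pos hu
    push_cast; linarith
  have h1 : (u - 1) ^ 2 ≤ u ^ 2 - 1 - Real.log (u ^ 2) := by nlinarith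
  have h2 : (u + 1) ^ 2 ≤ 2 * (R + 1) := by nlinarith [sq_nonneg (u - 1)]
  calc (u ^ 2 - 1) ^ 2 = (u + 1) ^ 2 * (u - 1) ^ 2 := by ring
    _ ≤ _ := mul_le_mul h2 h1 (sq_nonneg _) (by nlinarith)

theorem exists_abs_pow_sub_le (R : ℝ) (hR : 0 ≤ R) (n : ℕ) :
    ∃ C : ℝ, 0 ≤ C ∧ ∀ x : ℝ, 0 ≤ x → x ≤ R →
      |x ^ n - 1 - n * (x - 1)| ≤ C * (x - 1) ^ 2 := by
  induction n with
  | zero => exact ⟨0, le_rfl, fun x _ _ => by simp⟩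
  | succ n ih =>
    obtain ⟨C, hC, h⟩ := ih
    refine ⟨R * C + n, by positivity, fun x hx hxR => ?_⟩
    have hx' := h x hx hxR
    have : x ^ (n + 1) - 1 - ((n + 1 : ℕ) : ℝ) * (x - 1) =
        x * (x ^ n - 1 - n * (x - 1)) + n * (x - 1) ^ 2 := by
      push_cast; ring
    rw [this]
    calc _ ≤ |x * (x ^ n - 1 - n * (x - 1))| + |(n : ℝ) * (x - 1) ^ 2| := abs_add_le _ _
      _ = x * |x ^ n - 1 - n * (x - 1)| + n * (x - 1) ^ 2 := by
          rw [abs_mul, abs_of_nonneg hx, abs_of_nonneg (a := (n : ℝ) * (x - 1) ^ 2) (by positivity)]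
      _ ≤ R * (C * (x - 1) ^ 2) + n * (x - 1) ^ 2 := by gcongr
      _ = _ := by ring

/-- If `∑ x = t`, `0 ≤ x ≤ R` and `∑ x log x ≥ 0`, then all power sums of `x` differ from `t` by
at most a constant multiple of `∑ x² - t`, which is nonnegative. -/
theorem exists_abs_sum_pow_sub_le (R : ℝ) (hR : 0 ≤ R) (j : ℕ) (hj : 1 ≤ j) :
    ∃ M : ℝ, 0 ≤ M ∧ ∀ (V : Finset ℕ) (x : ℕ → ℝ), (∀ i ∈ V, 0 ≤ x i) → (∀ i ∈ V, x i ≤ R) →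
      0 ≤ ∑ i ∈ V, x i * Real.log (x i) →
      |∑ i ∈ V, x i ^ j - ∑ i ∈ V, x i| ≤ M * (∑ i ∈ V, x i ^ 2 - ∑ i ∈ V, x i) := by
  obtain ⟨n, rfl⟩ : ∃ n, j = n + 1 := ⟨j - 1, by omega⟩
  obtain ⟨C, hC, h⟩ := exists_abs_pow_sub_le R hR n
  refine ⟨n + C * (2 * (R + 1)), by positivity, fun V x hx hxR hlog => ?_⟩
  -- Factoring out `x i` leaves a Taylor remainder at `1`. On summation the term `- x log x` has a
  -- favourable sign and can be dropped.
  have hterm : ∀ i ∈ V, |x i ^ (n + 1) - x i - n * (x i ^ 2 - x i)| ≤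
      C * (2 * (R + 1)) * (x i ^ 2 - x i - x i * Real.log (x i)) := by
    intro i hi
    rcases (hx i hi).eq_or_lt with h0 | hpos
    · simp [← h0]
    have h1 := h (x i) hpos.le (hxR i hi)
    have h2 := sq_sub_one_le hpos (hxR i hi)
    calc _ = |x i * (x i ^ n - 1 - n * (x i - 1))| := by congr 1; ring
      _ = x i * |x i ^ n - 1 - n * (x i - 1)| := by rw [abs_mul, abs_of_pos hpos]
      _ ≤ x i * (C * (2 * (R + 1) * (x i - 1 - Real.log (x i)))) := by
          gcongr; exact h1.trans (by gcongr)
      _ = _ := by ring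
  have hnn : 0 ≤ ∑ i ∈ V, x i ^ 2 - ∑ i ∈ V, x i := by
    rw [← sum_sub_distrib]
    refine hlog.trans (sum_le_sum fun i hi => ?_)
    rcases (hx i hi).eq_or_lt with h0 | hpos
    · simp [← h0]
    have := Real.log_le_sub_one_of_pos hpos
    nlinarith
  have hsum : |∑ i ∈ V, x i ^ (n + 1) - ∑ i ∈ V, x i -
      n * (∑ i ∈ V, x i ^ 2 - ∑ i ∈ V, x i)| ≤
      C * (2 * (R + 1)) * (∑ i ∈ V, x i ^ 2 - ∑ i ∈ V, x i - ∑ i ∈ V, x i * Real.log (x i)) := by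
    simp only [← sum_sub_distrib, mul_sum]
    rw [← mul_sum]
    exact (abs_sum_le_sum_abs _ _).trans ((sum_le_sum hterm).trans_eq (by rw [mul_sum]))
  have hCR : 0 ≤ C * (2 * (R + 1)) := by positivity
  set E := ∑ i ∈ V, x i ^ 2 - ∑ i ∈ V, x i
  have hsum' := hsum.trans (mul_le_mul_of_nonneg_left (sub_le_self E hlog) hCR)
  calc _ = |(∑ i ∈ V, x i ^ (n + 1) - ∑ i ∈ V, x i - n * E) + n * E| := by congr 1; ring
    _ ≤ |∑ i ∈ V, x i ^ (n + 1) - ∑ i ∈ V, x i - n * E| + |n * E| := abs_add_le _ _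
    _ ≤ _ := by rw [abs_of_nonneg (a := (n : ℝ) * E) (by positivity)]; linarith

/-- For bounded nonnegative `x` with `∑ x = t` large and `∑ x log x ≥ 0`, the `r`-th elementary
symmetric sum is at most its value at `t` ones. -/
theorem exists_edgePoly_powersetCard_le_choose (R : ℝ) (hR : 0 ≤ R) (r : ℕ) (hr : 2 ≤ r) :
    ∃ T : ℕ, ∀ t : ℕ, T ≤ t → ∀ (V : Finset ℕ) (x : ℕ → ℝ), (∀ i ∈ V, 0 ≤ x i) →
      (∀ i ∈ V, x i ≤ R) → ∑ i ∈ V, x i = t → 0 ≤ ∑ i ∈ V, x i * Real.log (x i) →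
      edgePoly (V.powersetCard r) x ≤ t.choose r := by
  choose! M hM0 hM using exists_abs_sum_pow_sub_le R hR
  set N : ℝ := ∑ j ∈ Icc 1 r, M j
  have hN : ∀ j, 1 ≤ j → j ≤ r → M j ≤ N := fun j h1 h2 =>
    single_le_sum (f := M) (fun i hi => hM0 i (mem_Icc.1 hi).1) (mem_Icc.2 ⟨h1, h2⟩)
  have hN0 : 0 ≤ N := (hM0 1 le_rfl).trans (hN 1 le_rfl (by omega))
  -- This threshold makes the main term `t ^ (r + 1) / r !` dominate the error `r ^ 2 * N * t ^ r`.
  obtain ⟨T, hT⟩ := exists_nat_ge ((r : ℝ) ^ 2 * N * r.factorial)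
  refine ⟨T + 1, fun t ht V x hx hxR hs hlog => ?_⟩
  have ht1 : (1 : ℝ) ≤ t := by exact_mod_cast (show 1 ≤ t by omega)
  have htT : (r : ℝ) ^ 2 * N * r.factorial ≤ t :=
    hT.trans (by exact_mod_cast (show T ≤ t by omega))
  have hMV := fun j hj => hM j hj V x hx hxR hlog
  rw [hs] at hMV
  set E : ℝ := ∑ i ∈ V, x i ^ 2 - t with hE
  have hE0 : 0 ≤ E := by
    have : 0 ≤ ∑ i ∈ V, x i ^ 2 - ∑ i ∈ V, x i := by
      rw [← sum_sub_distrib]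
      refine hlog.trans (sum_le_sum fun i hi => ?_)
      rcases (hx i hi).eq_or_lt with h0 | hpos
      · simp [← h0]
      have := Real.log_le_sub_one_of_pos hpos
      nlinarith
    rwa [hs] at this
  have hb : ∀ k, edgePoly ((range t).powersetCard k) (fun _ => 1) = (t.choose k : ℝ) := by
    intro k; simp [edgePoly]
  have key := le_sub_of_newton (t := t) (E := E) (M := N) ht1 hE0 hN0
    (e := fun k => edgePoly (V.powersetCard k) x) (b := fun k => (t.choose k : ℝ))
    (p := fun j => ∑ i ∈ V, x i ^ j) r (by simp [edgePoly]) (by simp)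
    (fun k => by
      rw [abs_of_nonneg (edgePoly_nonneg (fun A hA => (mem_powersetCard.1 hA).1) hx), ← hs]
      exact edgePoly_powersetCard_le V x hx k)
    (fun k => edgePoly_nonneg (fun A hA => (mem_powersetCard.1 hA).1) hx)
    (by simpa using hs) (by simp [hE])
    (fun j h1 h2 => (hMV j h1).trans (mul_le_mul_of_nonneg_right (hN j h1 h2) hE0))
    (newton_identity V x)
    -- The binomial coefficients are the elementary symmetric sums of `t` ones, whose power sums all
    -- equal `t`.
    (fun k => by
      have := newton_identity (range t) (fun _ => 1) k
      simpa [hb] using this) r hr le_rfl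
  have hpos : 0 ≤ ((t : ℝ) ^ (r + 1) / r.factorial - (r : ℝ) ^ 2 * N * t ^ r) * E := by
    refine mul_nonneg ?_ hE0
    have hf : (0 : ℝ) < r.factorial := by exact_mod_cast Nat.factorial_pos r
    rw [sub_nonneg, le_div_iff₀ hf, pow_succ' (t : ℝ) r]
    calc _ = ((r : ℝ) ^ 2 * N * r.factorial) * t ^ r := by ring
      _ ≤ _ := mul_le_mul_of_nonneg_right htT (by positivity)
  have := nonneg_of_mul_nonneg_right (hpos.trans key) (by positivity)
  exact sub_nonneg.1 this

/-! ### Links, critical points and entropy. -/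

/-- The partial derivative of the edge polynomial of `H` with respect to the weight of `i`. -/
noncomputable def linkPoly (H : Finset (Finset ℕ)) (y : ℕ → ℝ) (i : ℕ) : ℝ :=
  ∑ A ∈ H with i ∈ A, ∏ j ∈ A.erase i, y j

theorem mul_linkPoly (H : Finset (Finset ℕ)) (y : ℕ → ℝ) (i : ℕ) :
    y i * linkPoly H y i = ∑ A ∈ H with i ∈ A, ∏ j ∈ A, y j := by
  rw [linkPoly, mul_sum]
  exact sum_congr rfl fun A hA => mul_prod_erase A y (mem_filter.1 hA).2

theorem edgePoly_update (H : Finset (Finset ℕ)) (y : ℕ → ℝ) (i : ℕ) (δ : ℝ) :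
    edgePoly H (Function.update y i (y i + δ)) = edgePoly H y + δ * linkPoly H y i := by
  rw [edgePoly, edgePoly, linkPoly, sum_filter, mul_sum, ← sum_add_distrib]
  refine sum_congr rfl fun A _ => ?_
  by_cases hi : i ∈ A
  · rw [if_pos hi, ← mul_prod_erase A _ hi, ← mul_prod_erase A y hi]
    have : ∏ j ∈ A.erase i, Function.update y i (y i + δ) j = ∏ j ∈ A.erase i, y j :=
      prod_congr rfl fun j hj => Function.update_of_ne (ne_of_mem_erase hj) _ _
    rw [this, Function.update_self]
    ring
  · rw [if_neg hi, mul_zero, add_zero]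
    exact prod_congr rfl fun j hj => Function.update_of_ne (ne_of_mem_of_not_mem hj hi) _ _

theorem edgePoly_mul {H : Finset (Finset ℕ)} {r : ℕ} (hr : ∀ A ∈ H, A.card = r) (c : ℝ)
    (y : ℕ → ℝ) : edgePoly H (fun i => c * y i) = c ^ r * edgePoly H y := by
  rw [edgePoly, edgePoly, mul_sum]
  refine sum_congr rfl fun A hA => ?_
  rw [prod_mul_distrib, prod_const, hr A hA]

/-- Double counting of incident pairs `(i, A)`. Taking `f = 1` gives Euler's identity, and `f = log`
passes between edge entropy and vertex entropy. -/
theorem sum_mul_linkPoly_mul {H : Finset (Finset ℕ)} {V : Finset ℕ} (hH : ∀ A ∈ H, A ⊆ V)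
    (y f : ℕ → ℝ) : ∑ i ∈ V, y i * linkPoly H y i * f i =
      ∑ A ∈ H, (∏ j ∈ A, y j) * ∑ i ∈ A, f i := by
  simp only [mul_linkPoly, sum_mul, mul_sum]
  refine sum_comm' fun i A => ?_
  simp only [mem_filter]
  exact ⟨fun h => ⟨h.2.2, h.2.1⟩, fun h => ⟨hH A h.2 h.1, h.2, h.1⟩⟩

/-- First-order optimality condition: at a maximiser of the edge polynomial, the partial
derivative with respect to each positive weight equals `r` times the maximum. -/
theorem mul_linkPoly_eq_of_isMax {H : Finset (Finset ℕ)} {V : Finset ℕ} {r : ℕ} {y : ℕ → ℝ}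
    (hH : ∀ A ∈ H, A ⊆ V) (hr : ∀ A ∈ H, A.card = r) (hy : IsWeightingOn V y)
    (hmax : ∀ z, IsWeightingOn V z → edgePoly H z ≤ edgePoly H y) {i : ℕ} (hi : i ∈ V) :
    y i * linkPoly H y i = y i * (r * edgePoly H y) := by
  have hle : ∀ i ∈ V, linkPoly H y i ≤ r * edgePoly H y := by
    intro i hi
    -- Add `δ` to the weight of `i` and renormalise by `1 + δ`. Homogeneity and maximality bound the
    -- link by a difference quotient, whose limit as `δ → 0+` is `r * edgePoly H y`.
    have hδ : ∀ δ : ℝ, 0 < δ → linkPoly H y i ≤ (∑ k ∈ range r, (1 + δ) ^ k) * edgePoly H y := by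
      intro δ hδ
      have h1 : (0 : ℝ) < 1 + δ := by linarith
      have hw : IsWeightingOn V fun j => (1 + δ)⁻¹ * Function.update y i (y i + δ) j := by
        refine ⟨fun j hj => mul_nonneg (by positivity) ?_, ?_⟩
        · by_cases hji : j = i
          · subst hji; rw [Function.update_self]; linarith [hy.1 j hj]
          · rw [Function.update_of_ne hji]; exact hy.1 j hj
        · rw [← mul_sum, sum_update_of_mem hi, add_right_comm, sdiff_singleton_eq_erase,
            add_sum_erase V y hi, hy.2, inv_mul_cancel₀ h1.ne']
      have h2 := hmax _ hw
      rw [edgePoly_mul hr, edgePoly_update, inv_pow, inv_mul_le_iff₀ (by positivity)] at h2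
      have h3 := geom_sum_mul (1 + δ) r
      rw [add_sub_cancel_left] at h3
      refine le_of_mul_le_mul_left ?_ hδ
      calc δ * linkPoly H y i ≤ ((1 + δ) ^ r - 1) * edgePoly H y := by linarith
        _ = _ := by rw [← h3]; ring
    have hc : Continuous fun δ : ℝ => (∑ k ∈ range r, (1 + δ) ^ k) * edgePoly H y := by fun_prop
    have ht := (hc.tendsto 0).mono_left (nhdsWithin_le_nhds (s := Set.Ioi 0))
    have := ge_of_tendsto ht (Filter.eventually_of_mem self_mem_nhdsWithin hδ)
    simpa using this
  -- By Euler's identity the weighted average of the links attains the upper bound, so every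
  -- nonnegative summand is zero.
  have hsum : ∑ i ∈ V, y i * (r * edgePoly H y - linkPoly H y i) = 0 := by
    have h := sum_mul_linkPoly_mul hH y fun _ => 1
    simp only [mul_one, sum_const, nsmul_eq_mul] at h
    have h' : ∑ A ∈ H, (∏ j ∈ A, y j) * (A.card : ℝ) = r * edgePoly H y := by
      rw [edgePoly, mul_sum]
      exact sum_congr rfl fun A hA => by rw [hr A hA, mul_comm]
    simp only [mul_sub, sum_sub_distrib]
    rw [h, h', ← sum_mul, hy.2, one_mul, sub_self]
  have := (sum_eq_zero_iff_of_nonneg fun i hi =>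
    mul_nonneg (hy.1 i hi) (sub_nonneg.2 (hle i hi))).1 hsum i hi
  linarith

/-- The entropy inequality `∑ z log z ≥ ∑ (z - 1)` over edge weights, at a critical point. -/
theorem edgePoly_sub_card_le {H : Finset (Finset ℕ)} {V : Finset ℕ} {x : ℕ → ℝ} {c : ℝ}
    (hH : ∀ A ∈ H, A ⊆ V) (hx : ∀ i ∈ V, 0 ≤ x i)
    (hc : ∀ i ∈ V, x i * linkPoly H x i = x i * c) :
    edgePoly H x - H.card ≤ c * ∑ i ∈ V, x i * Real.log (x i) := by
  have h1 : c * ∑ i ∈ V, x i * Real.log (x i) =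
      ∑ A ∈ H, (∏ j ∈ A, x j) * ∑ i ∈ A, Real.log (x i) := by
    rw [← sum_mul_linkPoly_mul hH, mul_sum]
    exact sum_congr rfl fun i hi => by rw [hc i hi]; ring
  have h2 : edgePoly H x - H.card = ∑ A ∈ H, ((∏ j ∈ A, x j) - 1) := by
    simp [edgePoly]
  rw [h1, h2]
  refine sum_le_sum fun A hA => ?_
  have hA0 : ∀ i ∈ A, 0 ≤ x i := fun i hi => hx i (hH A hA hi)
  rcases (prod_nonneg hA0).eq_or_lt with h0 | hpos
  · rw [← h0]; simp
  · rw [← Real.log_prod (fun i hi h => hpos.ne' (prod_eq_zero hi h))]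
    -- Applying `log w ≤ w - 1` to the inverse of the edge weight `z` gives `z log z ≥ z - 1`.
    have h3 := Real.log_le_sub_one_of_pos (inv_pos.2 hpos)
    rw [Real.log_inv] at h3
    have h4 := mul_le_mul_of_nonneg_left h3 hpos.le
    rw [mul_sub, mul_inv_cancel₀ hpos.ne'] at h4
    linarith

/-! ### Boundedness of optimal weights and the upper bound. -/

/-- Removing `i` embeds its link into the `r`-subsets of `V.erase i`, where the total weight is `1 -
y i`. -/
theorem factorial_mul_linkPoly_le {H : Finset (Finset ℕ)} {V : Finset ℕ} {r : ℕ} {y : ℕ → ℝ}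
    (hH : ∀ A ∈ H, A ⊆ V) (hr : ∀ A ∈ H, A.card = r + 1) (hy : IsWeightingOn V y)
    {i : ℕ} (hi : i ∈ V) : r.factorial * linkPoly H y i ≤ (1 - y i) ^ r := by
  have hy' : ∀ j ∈ V.erase i, 0 ≤ y j := fun j hj => hy.1 j (mem_of_mem_erase hj)
  have h1 : linkPoly H y i ≤ edgePoly ((V.erase i).powersetCard r) y := by
    have hinj : Set.InjOn (fun A : Finset ℕ => A.erase i) {A ∈ H | i ∈ A} := by
      intro A hA B hB hAB
      have hA' : i ∈ A := by simpa using hA.2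
      have hB' : i ∈ B := by simpa using hB.2
      rw [← insert_erase hA', ← insert_erase hB']
      exact congrArg (insert i) hAB
    rw [linkPoly, ← sum_image (g := fun A : Finset ℕ => A.erase i)
      (f := fun B : Finset ℕ => ∏ j ∈ B, y j) (by simpa using hinj)]
    refine sum_le_sum_of_subset_of_nonneg ?_ ?_
    · intro B hB
      obtain ⟨A, hA, rfl⟩ := mem_image.1 hB
      obtain ⟨hA, hiA⟩ := mem_filter.1 hA
      refine mem_powersetCard.2 ⟨erase_subset_erase _ (hH A hA), ?_⟩
      rw [card_erase_of_mem hiA, hr A hA, Nat.add_sub_cancel]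
    · intro B hB _
      exact prod_nonneg fun j hj => hy' j ((mem_powersetCard.1 hB).1 hj)
  have h2 := factorial_mul_edgePoly_powersetCard_le (V.erase i) y hy' r
  have h3 := add_sum_erase V y hi
  rw [hy.2] at h3
  rw [show ∑ j ∈ V.erase i, y j = 1 - y i by linarith] at h2
  exact (mul_le_mul_of_nonneg_left h1 (Nat.cast_nonneg _)).trans h2

/-- Bernoulli bounds the left side of `h` below by `1 - (r + 1) * r / t`, and `(1 - u) ^ r * (1 + r
* u) ≤ 1` bounds the right side above. Since `t - (r + 1) * r ≥ t / 2`, the claim follows. -/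
theorem le_of_pow_le {r : ℕ} {t u : ℝ} (hr : 1 ≤ r) (ht : 2 * (r + 1) * r ≤ t) (hu : 0 ≤ u)
    (hu1 : u ≤ 1) (h : (1 - r / t) ^ (r + 1) ≤ (1 - u) ^ r) : t * u ≤ 2 * (r + 1) := by
  have hr' : (1 : ℝ) ≤ r := by exact_mod_cast hr
  have ht0 : 0 < t := by nlinarith
  have h1 : 1 - (r + 1) * (r / t) ≤ (1 - r / t) ^ (r + 1) := by
    have := one_add_mul_le_pow (a := -(r / t : ℝ)) ?_ (r + 1)
    · push_cast at this
      rw [← sub_eq_add_neg] at this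
      linarith
    · have : (r : ℝ) / t ≤ 1 := by rw [div_le_one ht0]; nlinarith
      linarith
  have h2 : 1 + r * u ≤ (1 + u) ^ r := one_add_mul_le_pow (by linarith) r
  have h3 : (1 - u) ^ r * (1 + u) ^ r ≤ 1 := by
    rw [← mul_pow]
    exact pow_le_one₀ (by nlinarith) (by nlinarith)
  have h4 : (1 - (r + 1) * (r / t)) * (1 + r * u) ≤ 1 :=
    le_trans (mul_le_mul (h1.trans h) h2 (by positivity) (pow_nonneg (by linarith) _)) h3
  have h5 : (t - (r + 1) * r) * (1 + r * u) ≤ t := by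
    calc _ = t * ((1 - (r + 1) * (r / t)) * (1 + r * u)) := by field_simp
      _ ≤ t * 1 := by gcongr
      _ = t := mul_one t
  have h6 : r * (t * u) ≤ r * (2 * (r + 1)) := by
    have : 0 ≤ (t - 2 * (r + 1) * r) * (r * u) :=
      mul_nonneg (by linarith) (by positivity)
    nlinarith
  exact le_of_mul_le_mul_left h6 (by linarith)

/-- For `t` large, an `r`-graph with `t.choose r` edges has Lagrangian at most
`t.choose r / t ^ r`. -/
theorem exists_lagrangian_le (r : ℕ) (hr : 2 ≤ r) :
    ∃ T : ℕ, ∀ t : ℕ, T ≤ t → ∀ H : Finset (Finset ℕ), (∀ A ∈ H, A.card = r) →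
      H.card = t.choose r → lagrangian H ≤ (t.choose r : ℝ) / (t : ℝ) ^ r := by
  obtain ⟨s, rfl⟩ : ∃ s, r = s + 1 := ⟨r - 1, by omega⟩
  obtain ⟨T, hT⟩ := exists_edgePoly_powersetCard_le_choose (2 * ((s : ℝ) + 1)) (by positivity)
    (s + 1) hr
  refine ⟨max T (2 * (s + 1) * s), fun t ht H hcard hm => ?_⟩
  have hs1 : 1 ≤ s := by omega
  have htT : T ≤ t := (le_max_left _ _).trans ht
  have hts : 2 * (s + 1) * s ≤ t := (le_max_right _ _).trans ht
  have hst : s ≤ t := by nlinarith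
  have ht0 : (0 : ℝ) < t := by exact_mod_cast (show 0 < t by omega)
  -- Inserting `0` keeps `V` nonempty even if `H` has no edges.
  obtain ⟨V, hVne, hV⟩ : ∃ V : Finset ℕ, V.Nonempty ∧ ∀ A ∈ H, A ⊆ V :=
    ⟨insert 0 (H.biUnion id), insert_nonempty _ _, fun A hA =>
      (subset_biUnion_of_mem id hA).trans (subset_insert _ _)⟩
  obtain ⟨⟨y, hy, hyl⟩, hub⟩ := isGreatest_lagrangian H V hVne hV
  have hmax : ∀ z, IsWeightingOn V z → edgePoly H z ≤ edgePoly H y := fun z hz => by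
    rw [hyl]; exact hub ⟨z, hz, rfl⟩
  rw [← hyl]
  by_contra! hlt
  rw [div_lt_iff₀ (by positivity)] at hlt
  have hL0 : 0 < edgePoly H y :=
    pos_of_mul_pos_left ((Nat.cast_nonneg _).trans_lt hlt) (by positivity)
  have hkkt := fun i hi => mul_linkPoly_eq_of_isMax hV hcard hy hmax (i := i) hi
  set x : ℕ → ℝ := fun i => t * y i with hxdef
  have hx0 : ∀ i ∈ V, 0 ≤ x i := fun i hi => mul_nonneg ht0.le (hy.1 i hi)
  have hLx : edgePoly H x = t ^ (s + 1) * edgePoly H y := edgePoly_mul hcard _ _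
  have hsum : ∑ i ∈ V, x i = t := by rw [← mul_sum, hy.2, mul_one]
  have hkx : ∀ i ∈ V, x i * linkPoly H x i =
      x i * (t ^ s * ((s + 1 : ℕ) * edgePoly H y)) := by
    intro i hi
    have h1 : x i * linkPoly H x i = t ^ (s + 1) * (y i * linkPoly H y i) := by
      rw [mul_linkPoly, mul_linkPoly]
      exact edgePoly_mul (fun A hA => hcard A (mem_filter.1 hA).1) _ _
    rw [h1, hkkt i hi, hxdef]
    ring
  have hent := edgePoly_sub_card_le hV hx0 hkx
  have hlog : 0 ≤ ∑ i ∈ V, x i * Real.log (x i) := by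
    refine (pos_of_mul_pos_right (lt_of_lt_of_le ?_ hent) (by positivity)).le
    rw [hLx, hm, sub_pos]
    linarith
  have hxR : ∀ i ∈ V, x i ≤ 2 * ((s : ℝ) + 1) := by
    intro i hi
    rcases (hy.1 i hi).eq_or_lt with h0 | hpos
    · rw [hxdef]; simp only [← h0, mul_zero]; positivity
    have hlink := mul_left_cancel₀ hpos.ne' (hkkt i hi)
    have h1 := factorial_mul_linkPoly_le hV hcard hy hi
    have hy1 : y i ≤ 1 := by rw [← hy.2]; exact single_le_sum hy.1 hi
    refine le_of_pow_le hs1 (by exact_mod_cast hts) hpos.le hy1 (le_trans ?_ h1)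
    -- Together with `hlt` this bounds `(1 - s / t) ^ (s + 1)` by `(s + 1)! * edgePoly H y`, which
    -- equals `s ! * linkPoly H y i` by optimality.
    have h2 : ((t : ℝ) - s) ^ (s + 1) ≤ (s + 1).factorial * t.choose (s + 1) := by
      have := Nat.pow_sub_le_descFactorial t (s + 1)
      rw [Nat.descFactorial_eq_factorial_mul_choose, Nat.add_sub_add_right] at this
      rw [← Nat.cast_sub hst]
      exact_mod_cast this
    have h3 : (1 - (s : ℝ) / t) ^ (s + 1) = ((t : ℝ) - s) ^ (s + 1) / t ^ (s + 1) := by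
      rw [← div_pow, sub_div, div_self ht0.ne']
    rw [h3, div_le_iff₀ (by positivity), hlink]
    refine h2.trans ?_
    rw [Nat.factorial_succ]
    have hf : (0 : ℝ) ≤ ((s + 1 : ℕ) : ℝ) * s.factorial := by positivity
    have := mul_le_mul_of_nonneg_left hlt.le hf
    push_cast at *
    linarith
  have hfin := hT t htT V x hx0 hxR hsum hlog
  have hsub : edgePoly H x ≤ edgePoly (V.powersetCard (s + 1)) x :=
    sum_le_sum_of_subset_of_nonneg
      (fun A hA => mem_powersetCard.2 ⟨hV A hA, hcard A hA⟩)
      (fun A hA _ => prod_nonneg fun j hj => hx0 j ((mem_powersetCard.1 hA).1 hj))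
  rw [hLx] at hsub
  linarith

/-! ### The uniform weighting and the conclusion. -/

theorem choose_div_le_lagrangian_completeRGraph (t r : ℕ) (ht : 1 ≤ t) :
    (t.choose r : ℝ) / (t : ℝ) ^ r ≤ lagrangian (completeRGraph t r) := by
  have ht0 : (t : ℝ) ≠ 0 := by exact_mod_cast (show t ≠ 0 by omega)
  refine (isGreatest_lagrangian (completeRGraph t r) (Icc 1 t) ⟨1, by simp [ht]⟩
    fun A hA => (mem_powersetCard.1 hA).1).2 ⟨fun _ => (t : ℝ)⁻¹, ⟨fun _ _ => by positivity, ?_⟩, ?_⟩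
  · simp [ht0]
  · have : edgePoly (completeRGraph t r) (fun _ => (t : ℝ)⁻¹) =
        ∑ A ∈ completeRGraph t r, ((t : ℝ)⁻¹) ^ r :=
      sum_congr rfl fun A hA => by rw [prod_const, (mem_powersetCard.1 hA).2]
    rw [this]
    simp [completeRGraph, div_eq_mul_inv]

end HypergraphLagrangian

theorem corollary1p3 (r : ℕ) (hr : 4 ≤ r) :
    ∃ t_r : ℕ, ∀ t : ℕ, t_r ≤ t →
      IsGreatest
        {x : ℝ | ∃ H : Finset (Finset ℕ), (∀ A ∈ H, A.card = r) ∧ H.card = t.choose r ∧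
          HypergraphLagrangian.lagrangian H = x}
        (HypergraphLagrangian.lagrangian (HypergraphLagrangian.completeRGraph t r)) ∧
      HypergraphLagrangian.lagrangian (HypergraphLagrangian.completeRGraph t r) =
        (t.choose r : ℝ) / (t : ℝ) ^ r := by
  obtain ⟨T, hT⟩ := HypergraphLagrangian.exists_lagrangian_le r (by omega)
  -- The extra `1` ensures `t ≥ 1`, so that `[t]` carries a uniform weighting.
  refine ⟨T + 1, fun t ht => ?_⟩
  have hcard : ∀ A ∈ HypergraphLagrangian.completeRGraph t r, A.card = r :=
    fun A hA => (Finset.mem_powersetCard.1 hA).2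
  have hm : (HypergraphLagrangian.completeRGraph t r).card = t.choose r := by
    simp [HypergraphLagrangian.completeRGraph]
  have heq := le_antisymm (hT t (by omega) _ hcard hm)
    (HypergraphLagrangian.choose_div_le_lagrangian_completeRGraph t r (by omega))
  refine ⟨⟨⟨_, hcard, hm, rfl⟩, ?_⟩, heq⟩
  rintro _ ⟨H, hH, hHm, rfl⟩
  rw [heq]
  exact hT t (by omega) H hH hHm
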